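/- Let $d\ge 3$ and $N\ge 1$ be integers and equip $(\mathbb{R}^d)^N$ with the Euclidean norm. A point set $X=(x^{(1)},\dots,x^{(N)})\in(\mathbb{R}^d)^N$ is called generic if for every $I\subseteq\{1,\dots,N\}$ with $\#I\le d$ the family $(x^{(i)})_{i\in I}$ is linearly independent. Let $\Phi$ be the family of all $I\subseteq\{1,\dots,N\}$ with $1\le\#I\le d$. For generic $X$ and $I\in\Phi$ let $X_I$ be the matrix with columns $x^{(i)}$ ($i\in I$), let $\mathbf 1=(1,\dots,1)^\top\in\mathbb{R}^{\#I}$, and put $$t_I(X)=\left(\mathbf 1^\top (X_I^\top X_I)^{-1}\mathbf 1\right)^{-1/2},\qquad w_I(X)=t_I(X)\,X_I(X_I^\top X_I)^{-1}\mathbf 1 .$$ For $w\in\mathbb{R}^d$ and $t\in\mathbb{R}$ let $$\mu^{Emp}(X,w,t)=N^{-1}\cdot\#\{i\in\{1,\dots,N\} : \langle w,x^{(i)}\rangle\ge t\}.$$ For $t\in[-1,1]$ let $\mu^{cap}(t)=\sigma(\{x\in\mathbb{S}^{d-1} : \langle w,x\rangle\ge t\})$, where $\sigma$ is the uniform distribution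 on the unit sphere $\mathbb{S}^{d-1}$ of $\mathbb{R}^d$ and $w$ is any unit vector (the value does not depend on $w$). Let $\mu^{Cap}:\mathbb{R}\to\mathbb{R}$ be the extension given by $\mu^{Cap}(t)=\mu^{cap}(t)$ for $|t|\le 1$ and, for $|t|>1$, by $\mu^{Cap}(t)=-\frac12 t+\frac12$ if $d=3$, while if $d\ge 4$ then $\mu^{Cap}(t)=0$ for $t>1$ and $\mu^{Cap}(t)=1$ for $t<-1$. For generic $X$ define the generalized cap discrepancy $$\Lambda(X)=\max_{I\in\Phi}\max\left\{\mu^{Emp}(X,w_I(X),t_I(X))-\mu^{Cap}(t_I(X)),\ \mu^{Emp}(X,-w_I(X),-t_I(X))-\mu^{Cap}(-t_I(X))\right\}.$$ Theorem. Let $\bar X\in(\mathbb{R}^d)^N$ be generic. Then there is a neighbourhood $\mathcal U$ of $\bar X$ such that every $X\in\mathcal U$ is generic and $\Lambda$ is Lipschitz continuous on $\mathcal U$, i.e. there is some $L>0$ with $$|\Lambda(X_1)-\Lambda(X_2)|\le L\,\|X_1-X_2\|\qquad\text{for all } X_1,X_2\in\mathcal U .$$ -/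

import Mathlib

open scoped Matrix Topology

noncomputable section

namespace SphericalCap

/-- The space `(ℝ^d)^N` of ordered point sets `X = (x⁽¹⁾, …, x⁽ᴺ⁾)`, with the Euclidean norm
`‖X‖ = (∑ i, ‖x⁽ⁱ⁾‖²)^(1/2)`; the point `x⁽ⁱ⁾` is `X i`. -/
abbrev PointSet (d N : ℕ) : Type :=
  PiLp 2 (fun _ : Fin N => EuclideanSpace ℝ (Fin d))

/-- `H(w, t) = {x ∈ ℝ^d | ⟨w, x⟩ ≥ t}`. -/
def halfSpace {d : ℕ} (w : EuclideanSpace ℝ (Fin d)) (t : ℝ) : Set (EuclideanSpace ℝ (Fin d)) :=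
  {x | t ≤ inner ℝ w x}

/-- The uniform distribution `σ` on the unit sphere `𝕊^(d-1)` of `ℝ^d`: the surface measure
induced by Lebesgue measure, normalized to total mass one. -/
def uniformSphere (d : ℕ) :
    MeasureTheory.Measure (Metric.sphere (0 : EuclideanSpace ℝ (Fin d)) 1) :=
  ((MeasureTheory.volume : MeasureTheory.Measure (EuclideanSpace ℝ (Fin d))).toSphere
      Set.univ)⁻¹ •
    (MeasureTheory.volume : MeasureTheory.Measure (EuclideanSpace ℝ (Fin d))).toSphere

/-- The cap measure `μ^cap(w, t) = σ(𝕊^(d-1) ∩ H(w, t))`. -/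
def capMeasureDir {d : ℕ} (w : EuclideanSpace ℝ (Fin d)) (t : ℝ) : ℝ :=
  (uniformSphere d).real {x | (x : EuclideanSpace ℝ (Fin d)) ∈ halfSpace w t}

/-- The first standard basis vector of `ℝ^d` (a unit vector as soon as `d ≥ 1`). -/
def pole (d : ℕ) : EuclideanSpace ℝ (Fin d) :=
  WithLp.toLp 2 (fun i : Fin d => if (i : ℕ) = 0 then 1 else 0)

/-- `μ^cap(t)`: the common value of `μ^cap(w, t)` over all unit vectors `w`
(see `capMeasure_eq`). -/
def capMeasure (d : ℕ) (t : ℝ) : ℝ := capMeasureDir (pole d) t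

theorem norm_pole {d : ℕ} (hd : 1 ≤ d) : ‖pole d‖ = 1 := by
  have h : pole d = EuclideanSpace.single (⟨0, hd⟩ : Fin d) (1 : ℝ) := by
    ext i
    simp [pole, Fin.ext_iff]
  rw [h]; simp

/-- The cap measure does not depend on the direction. -/
theorem capMeasureDir_eq {d : ℕ} {v w : EuclideanSpace ℝ (Fin d)} (h : ‖v‖ = ‖w‖) (t : ℝ) :
    capMeasureDir v t = capMeasureDir w t := by
  obtain ⟨e, he⟩ : ∃ e : EuclideanSpace ℝ (Fin d) ≃ₗᵢ[ℝ] EuclideanSpace ℝ (Fin d), e v = w :=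
    ⟨(ℝ ∙ (v - w))ᗮ.reflection, Submodule.reflection_sub h⟩
  have hm : ∀ u : EuclideanSpace ℝ (Fin d), MeasurableSet
      {x : Metric.sphere (0 : EuclideanSpace ℝ (Fin d)) 1 |
        (x : EuclideanSpace ℝ (Fin d)) ∈ halfSpace u t} := fun u => by
    have h : IsClosed (halfSpace u t) :=
      isClosed_le continuous_const (continuous_const.inner continuous_id)
    exact measurable_subtype_coe h.measurableSet
  have hin : ∀ x, inner ℝ w (e x) = inner ℝ v x := fun x => by
    rw [← he, LinearIsometryEquiv.inner_map_map]
  have key : (MeasureTheory.volume : MeasureTheory.Measure (EuclideanSpace ℝ (Fin d))).toSphere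
        {x | (x : EuclideanSpace ℝ (Fin d)) ∈ halfSpace v t} =
      (MeasureTheory.volume : MeasureTheory.Measure (EuclideanSpace ℝ (Fin d))).toSphere
        {x | (x : EuclideanSpace ℝ (Fin d)) ∈ halfSpace w t} := by
    have hvol : ∀ S : Set (EuclideanSpace ℝ (Fin d)),
        MeasureTheory.volume (e ⁻¹' S) = MeasureTheory.volume S := fun S =>
      e.measurePreserving.measure_preimage_equiv
        (f := e.toHomeomorph.toMeasurableEquiv) S
    rw [MeasureTheory.Measure.toSphere_apply' _ (hm v),
      MeasureTheory.Measure.toSphere_apply' _ (hm w)]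
    refine congrArg _ (Eq.trans ?_ (hvol _))
    congr 1
    ext x
    constructor
    · rintro ⟨r, hr, _, ⟨y, hy, rfl⟩, rfl⟩
      refine ⟨r, hr, e y, ⟨⟨e y, by simp⟩, ?_, rfl⟩, ?_⟩
      · simpa [halfSpace, hin] using hy
      · exact (e.map_smul r y).symm
    · rintro ⟨r, hr, _, ⟨y, hy, rfl⟩, hx⟩
      refine ⟨r, hr, e.symm y, ⟨⟨e.symm y, by simp⟩, ?_, rfl⟩, ?_⟩
      · have := hin (e.symm y)
        rw [e.apply_symm_apply] at this
        simpa [halfSpace, ← this] using hy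
      · apply e.injective
        simpa using hx
  simp only [capMeasureDir, uniformSphere, MeasureTheory.measureReal_def,
    MeasureTheory.Measure.smul_apply, key]

theorem capMeasure_eq {d : ℕ} {w : EuclideanSpace ℝ (Fin d)} (hw : ‖w‖ = 1) (hd : 1 ≤ d) (t : ℝ) :
    capMeasureDir w t = capMeasure d t :=
  capMeasureDir_eq (hw.trans (norm_pole hd).symm) t

/-- The extended cap measure `μ^Cap : ℝ → ℝ` (meant for `d ≥ 3`): `μ^cap` on `[-1, 1]`; outside,
the affine function `-t/2 + 1/2` if `d = 3`, and the constants `0` (for `t > 1`) and `1`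
(for `t < -1`) if `d ≥ 4`. -/
def extCapMeasure (d : ℕ) (t : ℝ) : ℝ :=
  if t ∈ Set.Icc (-1 : ℝ) 1 then capMeasure d t
  else if d = 3 then -(1 / 2) * t + 1 / 2
  else if 1 < t then 0
  else 1

/-- The extended empirical measure `μ^Emp(X, w, t) = N⁻¹ · #{i | x⁽ⁱ⁾ ∈ H(w, t)}`. -/
def extEmpMeasure {d N : ℕ} (X : PointSet d N) (w : EuclideanSpace ℝ (Fin d)) (t : ℝ) : ℝ :=
  (N : ℝ)⁻¹ * ({i : Fin N | X i ∈ halfSpace w t}.ncard : ℝ)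

/-- A point set is generic if every subfamily of at most `d` of its points is linearly
independent. -/
def IsGeneric {d N : ℕ} (X : PointSet d N) : Prop :=
  ∀ I : Finset (Fin N), I.card ≤ d → LinearIndependent ℝ (fun i : I => X i)

/-- The family `Φ` of index sets `I ⊆ {1, …, N}` with `1 ≤ #I ≤ d`. -/
def indexFamily (d N : ℕ) : Set (Finset (Fin N)) :=
  {I | 1 ≤ I.card ∧ I.card ≤ d}

/-- The matrix `X_I` whose columns are the points `x⁽ⁱ⁾`, `i ∈ I`. -/
def subMatrix {d N : ℕ} (X : PointSet d N) (I : Finset (Fin N)) : Matrix (Fin d) I ℝ :=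
  Matrix.of fun k i => X i k

/-- The vector `(X_Iᵀ X_I)⁻¹ 𝟏`. -/
def gramInvOne {d N : ℕ} (X : PointSet d N) (I : Finset (Fin N)) : I → ℝ :=
  ((subMatrix X I)ᵀ * subMatrix X I)⁻¹ *ᵥ 1

/-- `t_I(X) = (𝟏ᵀ (X_Iᵀ X_I)⁻¹ 𝟏)^(-1/2)`. -/
def height {d N : ℕ} (X : PointSet d N) (I : Finset (Fin N)) : ℝ :=
  (1 ⬝ᵥ gramInvOne X I) ^ (-(1 / 2) : ℝ)

/-- `w_I(X) = t_I(X) X_I (X_Iᵀ X_I)⁻¹ 𝟏`. -/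
def normal {d N : ℕ} (X : PointSet d N) (I : Finset (Fin N)) : EuclideanSpace ℝ (Fin d) :=
  WithLp.toLp 2 (height X I • (subMatrix X I *ᵥ gramInvOne X I))

/-- The generalized cap discrepancy `Λ(X)`. The supremum is over the finite family `Φ`, which is
nonempty when `d, N ≥ 1`, so that it is a maximum. Only its values at generic `X` matter. -/
def capDiscrepancy {d N : ℕ} (X : PointSet d N) : ℝ :=
  ⨆ I : indexFamily d N,
    max (extEmpMeasure X (normal X I) (height X I) - extCapMeasure d (height X I))
      (extEmpMeasure X (-normal X I) (-height X I) - extCapMeasure d (-height X I))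

end SphericalCap

end

noncomputable section

namespace SphericalCap

/-! ### Volume between coaxial cones, by polar coordinates. -/

section

open MeasureTheory Set

/-! Write u_I for the vector in the span of the chosen points with ⟨u_I, x⁽ⁱ⁾⟩ = 1 on I. Then the
height is 1/‖u_I‖, and the two caps of I are s ≤ s⟨u_I, x⟩ with s = ±1. Near a generic set u_I is C¹
and nonzero, so the heights are locally Lipschitz. The extended cap measure is globally Lipschitz
(`exists_extCapMeasure_sub_le`): for d ≥ 3 a band on the sphere has measure at most a constant times
its width.

The counts jump, but their jumps do not reach the maximum. Let X be close to a generic Y. A point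
strictly outside a cap of Y stays outside, so keeping I can only lower the count. Conversely, a
point on the boundary hyperplane may leave the cap of I, but another index set J with the same
hyperplane at Y gives a cap of X that keeps all the points (`eventually_exists_supporting`). Hence
|Λ(X) - Λ(Y)| is at most a constant times the largest change of height.

The neighbourhood of Y on which this holds depends on Y, but the constant does not. On a ball, which
is convex, such pointwise bounds integrate along segments to a Lipschitz bound
(`abs_sub_le_of_eventually_abs_sub_le`). -/

theorem lintegral_fun_norm {E : Type*} [NormedAddCommGroup E] [NormedSpace ℝ E]
    [MeasurableSpace E] [Nontrivial E] [FiniteDimensional ℝ E] [BorelSpace E] (μ : Measure E)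
    [μ.IsAddHaarMeasure] {f : ℝ → ENNReal} (hf : Measurable f) :
    ∫⁻ x, f ‖x‖ ∂μ = μ.toSphere univ *
      ∫⁻ r in Ioi (0 : ℝ), ENNReal.ofReal (r ^ (Module.finrank ℝ E - 1)) * f r := by
  calc
    ∫⁻ x, f ‖x‖ ∂μ = ∫⁻ x : ({(0)}ᶜ : Set E), f ‖x.1‖ ∂(μ.comap (↑)) := by
      rw [lintegral_subtype_comap (measurableSet_singleton _).compl fun x ↦ f (‖x‖),
        restrict_compl_singleton]
    _ = ∫⁻ x, f x.2 ∂μ.toSphere.prod (.volumeIoiPow (Module.finrank ℝ E - 1)) := by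
      simpa using μ.measurePreserving_homeomorphUnitSphereProd.lintegral_comp_emb
        (Homeomorph.measurableEmbedding _) (f ∘ Subtype.val ∘ Prod.snd)
    _ = μ.toSphere univ *
        ∫⁻ x : Ioi (0 : ℝ), f x ∂.volumeIoiPow (Module.finrank ℝ E - 1) := by
      have hm : Measurable fun x : Ioi (0 : ℝ) => f x := hf.comp measurable_subtype_coe
      refine (lintegral_prod _ (hm.comp measurable_snd).aemeasurable).trans ?_
      simp [mul_comm]
    _ = _ := by
      have hm : Measurable fun x : Ioi (0 : ℝ) => f x := hf.comp measurable_subtype_coe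
      rw [Measure.volumeIoiPow, lintegral_withDensity_eq_lintegral_mul _ (by fun_prop) hm,
        ← lintegral_subtype_comap measurableSet_Ioi]
      rfl

/-- Substitute c = cos θ, which is injective on (0, π) with |dc| = sin θ dθ. -/
theorem lintegral_sin_cos_preimage_le (s t : ℝ) :
    ∫⁻ θ in Ioo 0 Real.pi ∩ Real.cos ⁻¹' Icc s t, ENNReal.ofReal (Real.sin θ) ≤
      ENNReal.ofReal (t - s) := by
  have hS : MeasurableSet (Ioo 0 Real.pi ∩ Real.cos ⁻¹' Icc s t) :=
    measurableSet_Ioo.inter (Real.measurable_cos measurableSet_Icc)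
  have h := lintegral_image_eq_lintegral_abs_deriv_mul hS
    (fun x _ => (Real.hasDerivAt_cos x).hasDerivWithinAt)
    (Real.injOn_cos.mono (inter_subset_left.trans Ioo_subset_Icc_self)) (fun _ => 1)
  calc _ = ∫⁻ θ in Ioo 0 Real.pi ∩ Real.cos ⁻¹' Icc s t,
        ENNReal.ofReal |-Real.sin θ| * 1 := by
        refine setLIntegral_congr_fun hS fun θ hθ => ?_
        have := Real.sin_pos_of_mem_Ioo hθ.1
        simp [abs_of_pos this]
    _ = volume (Real.cos '' (Ioo 0 Real.pi ∩ Real.cos ⁻¹' Icc s t)) := by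
        rw [← h]; simp
    _ ≤ volume (Icc s t) := by
        refine measure_mono ?_
        rintro _ ⟨θ, hθ, rfl⟩
        exact hθ.2
    _ = _ := by simp

/-- The sector `s ≤ cos θ ≤ t` of the open unit disk. -/
def sector (s t : ℝ) : Set (ℝ × ℝ) :=
  {p | p.1 ^ 2 + p.2 ^ 2 < 1 ∧ s * √(p.1 ^ 2 + p.2 ^ 2) ≤ p.1 ∧
    p.1 ≤ t * √(p.1 ^ 2 + p.2 ^ 2)}

theorem measurableSet_sector (s t : ℝ) : MeasurableSet (sector s t) :=
  MeasurableSet.inter (s₁ := {p : ℝ × ℝ | p.1 ^ 2 + p.2 ^ 2 < 1})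
    (measurableSet_lt (by fun_prop) (by fun_prop))
    (MeasurableSet.inter (s₁ := {p : ℝ × ℝ | s * √(p.1 ^ 2 + p.2 ^ 2) ≤ p.1})
      (s₂ := {p : ℝ × ℝ | p.1 ≤ t * √(p.1 ^ 2 + p.2 ^ 2)})
      (measurableSet_le (by fun_prop) (by fun_prop))
      (measurableSet_le (by fun_prop) (by fun_prop)))

/-- In polar coordinates the integrand with its Jacobian is ρ² sin θ ≤ sin θ, so the radial and
angular integrals separate. -/
theorem lintegral_sector_le (s t : ℝ) :
    ∫⁻ p : ℝ × ℝ, (sector s t).indicator (fun p => ENNReal.ofReal p.2) p ≤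
      ENNReal.ofReal (t - s) := by
  rw [← lintegral_comp_polarCoord_symm]
  have hA : MeasurableSet (Ioo 0 Real.pi ∩ Real.cos ⁻¹' Icc s t) :=
    measurableSet_Ioo.inter (Real.measurable_cos measurableSet_Icc)
  calc _ ≤ ∫⁻ p in polarCoord.target, (Ioo (0 : ℝ) 1).indicator 1 p.1 *
        (Ioo 0 Real.pi ∩ Real.cos ⁻¹' Icc s t).indicator
          (fun θ => ENNReal.ofReal (Real.sin θ)) p.2 := by
        refine setLIntegral_mono' polarCoord.open_target.measurableSet fun p hp => ?_
        obtain ⟨ρ, θ⟩ := p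
        obtain ⟨hρ, hθ⟩ : 0 < ρ ∧ θ ∈ Ioo (-Real.pi) Real.pi := by
          simpa [polarCoord] using hp
        by_cases hT : polarCoord.symm (ρ, θ) ∈ sector s t
        swap
        · rw [indicator_of_notMem hT, smul_zero]
          exact zero_le
        rw [indicator_of_mem hT]
        have hT' := hT
        simp only [sector, polarCoord_symm_apply, mem_ofPred_eq] at hT'
        have hsq : (ρ * Real.cos θ) ^ 2 + (ρ * Real.sin θ) ^ 2 = ρ ^ 2 := by
          linear_combination ρ ^ 2 * Real.sin_sq_add_cos_sq θ
        rw [hsq, Real.sqrt_sq hρ.le] at hT'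
        obtain ⟨h1, h2, h3⟩ := hT'
        have hρ1 : ρ < 1 := by nlinarith
        have hs : s ≤ Real.cos θ := le_of_mul_le_mul_left (by linarith) hρ
        have ht : Real.cos θ ≤ t := le_of_mul_le_mul_left (by linarith) hρ
        -- `ENNReal.ofReal` vanishes on the lower half plane, so only θ in (0, π) contributes.
        rcases le_or_gt (Real.sin θ) 0 with h0 | h0
        · have : ρ * Real.sin θ ≤ 0 := mul_nonpos_of_nonneg_of_nonpos hρ.le h0
          simp [ENNReal.ofReal_of_nonpos this]
        have hθ0 : 0 < θ := by
          by_contra! hn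
          exact absurd (Real.sin_nonpos_of_nonpos_of_neg_pi_le hn hθ.1.le) (not_le.2 h0)
        rw [indicator_of_mem (show (ρ, θ).1 ∈ Ioo (0 : ℝ) 1 from ⟨hρ, hρ1⟩),
          indicator_of_mem (show (ρ, θ).2 ∈ Ioo 0 Real.pi ∩ Real.cos ⁻¹' Icc s t from
            ⟨⟨hθ0, hθ.2⟩, hs, ht⟩)]
        simp only [polarCoord_symm_apply, Pi.one_apply, one_mul, smul_eq_mul]
        rw [← ENNReal.ofReal_mul hρ.le]
        refine ENNReal.ofReal_le_ofReal ?_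
        nlinarith [mul_nonneg hρ.le h0.le]
    _ ≤ ∫⁻ p : ℝ × ℝ, (Ioo (0 : ℝ) 1).indicator 1 p.1 *
        (Ioo 0 Real.pi ∩ Real.cos ⁻¹' Icc s t).indicator
          (fun θ => ENNReal.ofReal (Real.sin θ)) p.2 := setLIntegral_le_lintegral _ _
    _ = (∫⁻ ρ : ℝ, (Ioo (0 : ℝ) 1).indicator 1 ρ) *
        ∫⁻ θ, (Ioo 0 Real.pi ∩ Real.cos ⁻¹' Icc s t).indicator
          (fun θ => ENNReal.ofReal (Real.sin θ)) θ := by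
        refine lintegral_prod_mul ?_ ?_
        · exact (measurable_one.indicator measurableSet_Ioo).aemeasurable
        · exact ((by fun_prop : Measurable fun θ => ENNReal.ofReal (Real.sin θ)).indicator
            hA).aemeasurable
    _ ≤ _ := by
        rw [lintegral_indicator_one measurableSet_Ioo, lintegral_indicator hA]
        simpa using lintegral_sin_cos_preimage_le s t

/-- The volume of the intersection of the unit ball with the region between two coaxial cones. -/
theorem volume_cone_diff_le {F : Type*} [NormedAddCommGroup F] [InnerProductSpace ℝ F]
    [MeasurableSpace F] [BorelSpace F] [FiniteDimensional ℝ F] (hF : 2 ≤ Module.finrank ℝ F)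
    (s t : ℝ) :
    volume {p : ℝ × F | (p.1, ‖p.2‖) ∈ sector s t} ≤
      (volume : Measure F).toSphere univ * ENNReal.ofReal (t - s) := by
  have : Nontrivial F := Module.nontrivial_of_finrank_pos (R := ℝ) (by omega)
  have hT := measurableSet_sector s t
  have hm : Measurable fun p : ℝ × F => (p.1, ‖p.2‖) := by fun_prop
  have hsl : Measurable fun r : ℝ => volume {a : ℝ | (a, r) ∈ sector s t} :=
    measurable_measure_prodMk_right hT
  rw [show (volume : Measure (ℝ × F)) = (volume : Measure ℝ).prod volume from rfl,
    show {p : ℝ × F | (p.1, ‖p.2‖) ∈ sector s t} = (fun p => (p.1, ‖p.2‖)) ⁻¹' sector s t from rfl,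
    Measure.prod_apply_symm (hm hT)]
  refine (lintegral_fun_norm (volume : Measure F) hsl).trans_le ?_
  gcongr
  refine le_trans ?_ (lintegral_sector_le s t)
  have hind : Measurable ((sector s t).indicator fun p : ℝ × ℝ => ENNReal.ofReal p.2) :=
    (by fun_prop : Measurable fun p : ℝ × ℝ => ENNReal.ofReal p.2).indicator hT
  rw [show (volume : Measure (ℝ × ℝ)) = (volume : Measure ℝ).prod volume from rfl,
    lintegral_prod_symm _ hind.aemeasurable]
  refine (setLIntegral_mono' measurableSet_Ioi fun r hr => ?_).trans
    (setLIntegral_le_lintegral (Ioi 0) _)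
  have hr : 0 < r := hr
  have hsec : MeasurableSet {a : ℝ | (a, r) ∈ sector s t} := measurable_prodMk_right hT
  rw [show (fun a : ℝ => (sector s t).indicator (fun p : ℝ × ℝ => ENNReal.ofReal p.2) (a, r)) =
      {a : ℝ | (a, r) ∈ sector s t}.indicator (fun _ => ENNReal.ofReal r) from rfl,
    lintegral_indicator hsec, setLIntegral_const]
  -- Since dim F ≥ 2, the radial weight r^(dim F - 1) is at most r for r < 1. This is where d ≥ 3
  -- enters.
  rcases lt_or_ge r 1 with h1 | h1
  · gcongr
    exact pow_le_of_le_one hr.le h1.le (by omega)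
  · have : {a : ℝ | (a, r) ∈ sector s t} = ∅ := by
      ext a
      simp only [sector, mem_ofPred_eq, mem_empty_iff_false, iff_false]
      rintro ⟨h, -⟩
      nlinarith [sq_nonneg a]
    simp [this]

end

/-! ### Lipschitz continuity of the extended cap measure. -/

section

open MeasureTheory Set

/-- The surface measure of a set is d times the volume of the cone over it in the unit ball. After
an isometry from ℝ^d to ℝ × ℝ^(d-1), the cone over a band lies in the region between two coaxial
cones. -/
theorem exists_toSphere_band_le {d : ℕ} (hd : 3 ≤ d) :
    ∃ C : ENNReal, C ≠ ⊤ ∧ ∃ w : EuclideanSpace ℝ (Fin d), ‖w‖ = 1 ∧ ∀ s t : ℝ,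
      (volume : Measure (EuclideanSpace ℝ (Fin d))).toSphere
        {x | s ≤ inner ℝ w (x : EuclideanSpace ℝ (Fin d)) ∧
          inner ℝ w (x : EuclideanSpace ℝ (Fin d)) ≤ t} ≤ C * ENNReal.ofReal (t - s) := by
  let F := EuclideanSpace ℝ (Fin (d - 1))
  have hF : Module.finrank ℝ F = d - 1 := by simp [F]
  have hfr : Module.finrank ℝ (EuclideanSpace ℝ (Fin d)) =
      Module.finrank ℝ (WithLp 2 (ℝ × F)) := by
    rw [(WithLp.linearEquiv 2 ℝ (ℝ × F)).finrank_eq, Module.finrank_prod, hF,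
      finrank_euclideanSpace_fin, Module.finrank_self]
    omega
  let e : EuclideanSpace ℝ (Fin d) ≃ₗᵢ[ℝ] WithLp 2 (ℝ × F) :=
    (stdOrthonormalBasis ℝ _).equiv (stdOrthonormalBasis ℝ _) (finCongr hfr)
  refine ⟨Module.finrank ℝ (EuclideanSpace ℝ (Fin d)) * (volume : Measure F).toSphere univ,
    ENNReal.mul_ne_top (ENNReal.natCast_ne_top _) (measure_ne_top _ _),
    e.symm (WithLp.toLp 2 (1, 0)), ?_, fun s t => ?_⟩
  · rw [e.symm.norm_map, ← sq_eq_sq₀ (norm_nonneg _) zero_le_one, WithLp.prod_norm_sq_eq_of_L2]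
    simp
  have hin : ∀ x, inner ℝ (e.symm (WithLp.toLp 2 (1, 0))) x = (e x).fst := fun x => by
    rw [← e.inner_map_map, e.apply_symm_apply, WithLp.prod_inner_apply]
    simp
  have hnorm : ∀ x, √((e x).fst ^ 2 + ‖(e x).snd‖ ^ 2) = ‖x‖ := fun x => by
    rw [← e.norm_map, WithLp.prod_norm_eq_of_L2, Real.norm_eq_abs, sq_abs]
  have hband : MeasurableSet {x : Metric.sphere (0 : EuclideanSpace ℝ (Fin d)) 1 |
      s ≤ inner ℝ (e.symm (WithLp.toLp 2 (1, 0))) (x : EuclideanSpace ℝ (Fin d)) ∧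
        inner ℝ (e.symm (WithLp.toLp 2 (1, 0))) (x : EuclideanSpace ℝ (Fin d)) ≤ t} :=
    (by fun_prop : Measurable fun x : Metric.sphere (0 : EuclideanSpace ℝ (Fin d)) 1 =>
      inner ℝ (e.symm (WithLp.toLp 2 (1, 0))) (x : EuclideanSpace ℝ (Fin d))) measurableSet_Icc
  rw [Measure.toSphere_apply' _ hband, mul_assoc]
  gcongr
  have hmp : MeasurePreserving (fun x => WithLp.ofLp (e x)) volume volume :=
    (WithLp.volume_preserving_ofLp ℝ F).comp e.measurePreserving
  have hcone : MeasurableSet {p : ℝ × F | (p.1, ‖p.2‖) ∈ sector s t} :=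
    (by fun_prop : Measurable fun p : ℝ × F => (p.1, ‖p.2‖)) (measurableSet_sector s t)
  refine le_trans ?_ (volume_cone_diff_le (F := F) (by omega) s t)
  rw [← hmp.measure_preimage hcone.nullMeasurableSet]
  refine measure_mono ?_
  rintro _ ⟨r, ⟨hr0, hr1⟩, _, ⟨y, ⟨hy1, hy2⟩, rfl⟩, rfl⟩
  have hy : ‖(y : EuclideanSpace ℝ (Fin d))‖ = 1 := by simp
  rw [hin] at hy1 hy2
  have hn : ‖r • (y : EuclideanSpace ℝ (Fin d))‖ = r := by
    rw [norm_smul, hy, Real.norm_of_nonneg hr0.le, mul_one]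
  have hfst : (e (r • (y : EuclideanSpace ℝ (Fin d)))).fst = r * (e y).fst := by simp
  have h := hnorm (r • (y : EuclideanSpace ℝ (Fin d)))
  rw [hn] at h
  have h' : √((e (r • (y : EuclideanSpace ℝ (Fin d)))).fst ^ 2 +
      ‖(e (r • (y : EuclideanSpace ℝ (Fin d)))).snd‖ ^ 2) ^ 2 = r ^ 2 := by rw [h]
  rw [Real.sq_sqrt (by positivity)] at h'
  refine ⟨?_, ?_, ?_⟩
  · change (e (r • (y : EuclideanSpace ℝ (Fin d)))).fst ^ 2 +
      ‖(e (r • (y : EuclideanSpace ℝ (Fin d)))).snd‖ ^ 2 < 1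
    rw [h']
    nlinarith
  · change s * √((e (r • (y : EuclideanSpace ℝ (Fin d)))).fst ^ 2 +
      ‖(e (r • (y : EuclideanSpace ℝ (Fin d)))).snd‖ ^ 2) ≤
        (e (r • (y : EuclideanSpace ℝ (Fin d)))).fst
    rw [h, hfst]
    nlinarith
  · change (e (r • (y : EuclideanSpace ℝ (Fin d)))).fst ≤
      t * √((e (r • (y : EuclideanSpace ℝ (Fin d)))).fst ^ 2 +
      ‖(e (r • (y : EuclideanSpace ℝ (Fin d)))).snd‖ ^ 2)
    rw [h, hfst]
    nlinarith

theorem isProbabilityMeasure_uniformSphere {d : ℕ} (hd : 1 ≤ d) :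
    IsProbabilityMeasure (uniformSphere d) := by
  have : Nonempty (Fin d) := ⟨⟨0, hd⟩⟩
  refine ⟨?_⟩
  rw [uniformSphere, Measure.smul_apply, smul_eq_mul]
  exact ENNReal.inv_mul_cancel
    (Measure.measure_univ_ne_zero.2 (Measure.toSphere_ne_zero _)) (measure_ne_top _ _)

theorem exists_uniformSphere_band_le {d : ℕ} (hd : 3 ≤ d) :
    ∃ C : ℝ, 0 ≤ C ∧ ∃ w : EuclideanSpace ℝ (Fin d), ‖w‖ = 1 ∧ ∀ s t : ℝ, s ≤ t →
      (uniformSphere d).real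
        {x | s ≤ inner ℝ w (x : EuclideanSpace ℝ (Fin d)) ∧
          inner ℝ w (x : EuclideanSpace ℝ (Fin d)) ≤ t} ≤ C * (t - s) := by
  obtain ⟨C, hC, w, hw, h⟩ := exists_toSphere_band_le hd
  have : Nonempty (Fin d) := ⟨⟨0, by omega⟩⟩
  have hne := ENNReal.inv_ne_top.2 (Measure.measure_univ_ne_zero.2
    (Measure.toSphere_ne_zero (volume : Measure (EuclideanSpace ℝ (Fin d)))))
  refine ⟨(((volume : Measure (EuclideanSpace ℝ (Fin d))).toSphere univ)⁻¹ * C).toReal,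
    ENNReal.toReal_nonneg, w, hw, fun s t hst => ?_⟩
  rw [measureReal_def, ← ENNReal.toReal_ofReal (sub_nonneg.2 hst), ← ENNReal.toReal_mul]
  refine ENNReal.toReal_mono
    (ENNReal.mul_ne_top (ENNReal.mul_ne_top hne hC) ENNReal.ofReal_ne_top) ?_
  rw [uniformSphere, Measure.smul_apply, smul_eq_mul, mul_assoc]
  gcongr
  exact h s t

theorem exists_capMeasure_sub_le {d : ℕ} (hd : 3 ≤ d) :
    ∃ C : ℝ, 0 ≤ C ∧ (∀ s t, |capMeasure d s - capMeasure d t| ≤ C * |s - t|) ∧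
      (∀ t, 1 ≤ t → capMeasure d t = 0) ∧ ∀ t ≤ -1, capMeasure d t = 1 := by
  obtain ⟨C, hC, w, hw, h⟩ := exists_uniformSphere_band_le hd
  have := isProbabilityMeasure_uniformSphere (d := d) (by omega)
  have hcap : ∀ t, capMeasure d t = (uniformSphere d).real
      {x | t ≤ inner ℝ w (x : EuclideanSpace ℝ (Fin d))} := fun t =>
    (capMeasure_eq hw (by omega) t).symm
  have habs : ∀ x : Metric.sphere (0 : EuclideanSpace ℝ (Fin d)) 1,
      |inner ℝ w (x : EuclideanSpace ℝ (Fin d))| ≤ 1 := fun x => by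
    simpa [hw] using abs_real_inner_le_norm w (x : EuclideanSpace ℝ (Fin d))
  have hmono : ∀ s t, s ≤ t → capMeasure d t ≤ capMeasure d s := fun s t hst => by
    rw [hcap, hcap]
    exact measureReal_mono fun x hx => le_trans hst hx
  have hsub : ∀ s t, s ≤ t → capMeasure d s - capMeasure d t ≤ C * (t - s) := fun s t hst => by
    rw [sub_le_iff_le_add]
    refine le_trans ?_ (add_le_add_left (h s t hst) _)
    rw [hcap, hcap]
    refine (measureReal_mono fun x hx => ?_).trans (measureReal_union_le _ _)
    rcases le_total (inner ℝ w (x : EuclideanSpace ℝ (Fin d))) t with hx' | hx'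
    · exact Or.inl ⟨hx, hx'⟩
    · exact Or.inr hx'
  refine ⟨C, hC, fun s t => ?_, fun t ht => ?_, fun t ht => ?_⟩
  · rcases le_total s t with hst | hst
    · rw [abs_of_nonneg (sub_nonneg.2 (hmono s t hst)), abs_sub_comm,
        abs_of_nonneg (sub_nonneg.2 hst)]
      exact hsub s t hst
    · rw [abs_sub_comm, abs_of_nonneg (sub_nonneg.2 (hmono t s hst)),
        abs_of_nonneg (sub_nonneg.2 hst)]
      exact hsub t s hst
  · refine le_antisymm ?_ measureReal_nonneg
    rw [hcap]
    -- A band of width zero is null, and a cap of height at least 1 lies in it.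
    have h1 := h 1 1 le_rfl
    rw [sub_self, mul_zero] at h1
    refine (measureReal_mono fun x hx => ?_).trans h1
    exact ⟨le_trans ht hx, (abs_le.1 (habs x)).2⟩
  · rw [hcap, show {x : Metric.sphere (0 : EuclideanSpace ℝ (Fin d)) 1 |
      t ≤ inner ℝ w (x : EuclideanSpace ℝ (Fin d))} = univ from
        eq_univ_of_forall fun x => ht.trans (abs_le.1 (habs x)).1]
    exact probReal_univ

theorem exists_extCapMeasure_sub_le {d : ℕ} (hd : 3 ≤ d) :
    ∃ C : ℝ, 0 ≤ C ∧ ∀ s t, |extCapMeasure d s - extCapMeasure d t| ≤ C * |s - t| := by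
  obtain ⟨C, hC, hlip, hone, hneg⟩ := exists_capMeasure_sub_le hd
  let c : ℝ := if d = 3 then 1 / 2 else 0
  have hc : |c| ≤ 1 / 2 := by
    by_cases h : d = 3 <;> simp [c, h, abs_of_pos]
  -- q is the signed excess of t over [-1, 1]. As the cap measure is already 0 beyond 1 and 1 below
  -- -1, subtracting c * q yields the affine tails for d = 3 and changes nothing for d ≥ 4.
  let q : ℝ → ℝ := fun t => max (t - 1) 0 + min (t + 1) 0
  have hext : ∀ t, extCapMeasure d t = capMeasure d t - c * q t := fun t => by
    by_cases h3 : d = 3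
    · rcases lt_or_ge t (-1) with h1 | h1
      · rw [extCapMeasure, if_neg (fun h => h1.not_ge h.1), if_pos h3, hneg t h1.le]
        simp only [c, q, if_pos h3]
        rw [max_eq_right (by linarith), min_eq_left (by linarith)]
        ring
      rcases lt_or_ge 1 t with h2 | h2
      · rw [extCapMeasure, if_neg (fun h => h2.not_ge h.2), if_pos h3, hone t h2.le]
        simp only [c, q, if_pos h3]
        rw [max_eq_left (by linarith), min_eq_right (by linarith)]
        ring
      · rw [extCapMeasure, if_pos ⟨h1, h2⟩]
        simp only [q]
        rw [max_eq_right (by linarith), min_eq_right (by linarith)]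
        ring
    · simp only [c, if_neg h3, zero_mul, sub_zero]
      rcases lt_or_ge t (-1) with h1 | h1
      · rw [extCapMeasure, if_neg (fun h => h1.not_ge h.1), if_neg h3, if_neg (by linarith),
          hneg t h1.le]
      rcases lt_or_ge 1 t with h2 | h2
      · rw [extCapMeasure, if_neg (fun h => h2.not_ge h.2), if_neg h3, if_pos h2, hone t h2.le]
      · rw [extCapMeasure, if_pos ⟨h1, h2⟩]
  have hq : ∀ s t, |q s - q t| ≤ 2 * |s - t| := fun s t => by
    have h1 := abs_max_sub_max_le_max (s - 1) 0 (t - 1) 0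
    have h2 := abs_min_sub_min_le_max (s + 1) 0 (t + 1) 0
    simp only [sub_sub_sub_cancel_right, add_sub_add_right_eq_sub, sub_self, abs_zero,
      max_eq_left (abs_nonneg (s - t))] at h1 h2
    calc |q s - q t| = |(max (s - 1) 0 - max (t - 1) 0) + (min (s + 1) 0 - min (t + 1) 0)| := by
          simp only [q]; congr 1; ring
      _ ≤ _ := (abs_add_le _ _).trans (by linarith)
  refine ⟨C + 1, by linarith, fun s t => ?_⟩
  rw [hext, hext]
  calc |capMeasure d s - c * q s - (capMeasure d t - c * q t)|
      = |(capMeasure d s - capMeasure d t) - c * (q s - q t)| := by congr 1; ring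
    _ ≤ |capMeasure d s - capMeasure d t| + |c * (q s - q t)| := abs_sub _ _
    _ ≤ C * |s - t| + 1 / 2 * (2 * |s - t|) := by
        rw [abs_mul]
        gcongr
        · exact hlip s t
        · exact hq s t
    _ = _ := by ring

end

/-! ### Facet vectors and the regularity of the heights. -/

section

open Filter

section ContDiff

variable {E n : Type*} [NormedAddCommGroup E] [NormedSpace ℝ E] [Fintype n] [DecidableEq n]
  {m : WithTop ℕ∞} {A : E → Matrix n n ℝ} {x : E}

theorem contDiffAt_matrix_det (h : ∀ i j, ContDiffAt ℝ m (fun y => A y i j) x) :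
    ContDiffAt ℝ m (fun y => (A y).det) x := by
  simp only [Matrix.det_apply']
  exact ContDiffAt.sum fun σ _ => contDiffAt_const.mul (contDiffAt_prod fun i _ => h _ _)

theorem contDiffAt_matrix_inv_apply (h : ∀ i j, ContDiffAt ℝ m (fun y => A y i j) x)
    (hx : (A x).det ≠ 0) (i j : n) : ContDiffAt ℝ m (fun y => (A y)⁻¹ i j) x := by
  simp only [Matrix.inv_def, Ring.inverse_eq_inv', Matrix.smul_apply, Matrix.adjugate_apply,
    smul_eq_mul]
  refine ((contDiffAt_matrix_det h).inv hx).mul (contDiffAt_matrix_det fun k l => ?_)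
  by_cases hk : k = j
  · subst hk
    simpa using contDiffAt_const
  · simpa [Matrix.updateRow_ne hk] using h k l

end ContDiff

variable {d N : ℕ}

/-- The point `u` of the span of `(x⁽ⁱ⁾)_{i ∈ I}` with `⟨u, x⁽ⁱ⁾⟩ = 1` for all `i ∈ I`. -/
def facetVec (X : PointSet d N) (I : Finset (Fin N)) : EuclideanSpace ℝ (Fin d) :=
  WithLp.toLp 2 (subMatrix X I *ᵥ gramInvOne X I)

theorem subMatrix_gram (X : PointSet d N) (I : Finset (Fin N)) :
    (subMatrix X I)ᵀ * subMatrix X I = Matrix.gram ℝ (fun i : I => X i) := by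
  ext i j
  simp [subMatrix, Matrix.mul_apply, Matrix.gram, PiLp.inner_apply, mul_comm]

theorem det_gram_ne_zero {X : PointSet d N} {I : Finset (Fin N)}
    (hX : LinearIndependent ℝ (fun i : I => X i)) :
    ((subMatrix X I)ᵀ * subMatrix X I).det ≠ 0 := by
  rw [subMatrix_gram]
  exact Matrix.det_gram_ne_zero_iff_linearIndependent.2 hX

theorem facetVec_eq_sum (X : PointSet d N) (I : Finset (Fin N)) :
    facetVec X I = ∑ i : I, gramInvOne X I i • X i := by
  ext k
  simp [facetVec, subMatrix, Matrix.mulVec, dotProduct, mul_comm]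

theorem facetVec_mem_span (X : PointSet d N) (I : Finset (Fin N)) :
    facetVec X I ∈ Submodule.span ℝ (X '' I) := by
  rw [facetVec_eq_sum]
  exact Submodule.sum_mem _ fun i _ =>
    Submodule.smul_mem _ _ (Submodule.subset_span ⟨i, i.2, rfl⟩)

theorem inner_facetVec {X : PointSet d N} {I : Finset (Fin N)}
    (hX : LinearIndependent ℝ (fun i : I => X i)) {i : Fin N} (hi : i ∈ I) :
    inner ℝ (facetVec X I) (X i) = 1 := by
  have h : ((subMatrix X I)ᵀ * subMatrix X I) *ᵥ gramInvOne X I = 1 := by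
    rw [gramInvOne, Matrix.mulVec_mulVec,
      Matrix.mul_nonsing_inv _ (isUnit_iff_ne_zero.2 (det_gram_ne_zero hX)), Matrix.one_mulVec]
  have h' := congrFun h ⟨i, hi⟩
  rw [← Matrix.mulVec_mulVec] at h'
  simpa [facetVec, PiLp.inner_apply, Matrix.mulVec, dotProduct, subMatrix] using h'

/-- The difference lies in the span and is orthogonal to it. This uniqueness serves to identify
facet vectors. -/
theorem eq_of_inner_eq {X : PointSet d N} {I : Finset (Fin N)} {u v : EuclideanSpace ℝ (Fin d)}
    (hu : u ∈ Submodule.span ℝ (X '' I)) (hv : v ∈ Submodule.span ℝ (X '' I))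
    (h : ∀ i ∈ I, inner ℝ u (X i) = inner ℝ v (X i)) : u = v := by
  have ho : u - v ∈ (Submodule.span ℝ (X '' I))ᗮ := by
    rw [Submodule.mem_orthogonal']
    intro x hx
    induction hx using Submodule.span_induction with
    | mem x hx =>
      obtain ⟨i, hi, rfl⟩ := hx
      rw [inner_sub_left, h i hi, sub_self]
    | zero => simp
    | add x y _ _ hx hy => rw [inner_add_right, hx, hy, add_zero]
    | smul a x _ hx => rw [inner_smul_right, hx, mul_zero]
  refine sub_eq_zero.1 ?_
  have := Submodule.inner_right_of_mem_orthogonal (Submodule.sub_mem _ hu hv) ho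
  exact inner_self_eq_zero.1 this

theorem facetVec_ne_zero {X : PointSet d N} {I : Finset (Fin N)}
    (hX : LinearIndependent ℝ (fun i : I => X i)) (hI : I.Nonempty) : facetVec X I ≠ 0 := by
  obtain ⟨i, hi⟩ := hI
  intro h
  simpa [h] using inner_facetVec hX hi

/-- Expanding one factor of ⟨u, u⟩ in the points and using ⟨u, x⁽ⁱ⁾⟩ = 1 leaves the sum of the
coefficients, which is 𝟏ᵀ(X_Iᵀ X_I)⁻¹𝟏. -/
theorem height_eq {X : PointSet d N} {I : Finset (Fin N)}
    (hX : LinearIndependent ℝ (fun i : I => X i)) : height X I = ‖facetVec X I‖⁻¹ := by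
  have h : (1 : I → ℝ) ⬝ᵥ gramInvOne X I = ‖facetVec X I‖ ^ 2 := by
    rw [← real_inner_self_eq_norm_sq]
    nth_rewrite 2 [facetVec_eq_sum]
    rw [inner_sum]
    simp only [inner_smul_right, dotProduct, Pi.one_apply, one_mul]
    exact Finset.sum_congr rfl fun i _ => by rw [inner_facetVec hX i.2, mul_one]
  rw [height, h, Real.rpow_neg (sq_nonneg _), ← Real.sqrt_eq_rpow, Real.sqrt_sq (norm_nonneg _)]

theorem normal_eq {X : PointSet d N} {I : Finset (Fin N)}
    (hX : LinearIndependent ℝ (fun i : I => X i)) :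
    normal X I = ‖facetVec X I‖⁻¹ • facetVec X I := by
  rw [← height_eq hX]
  rfl

/-- The common positive factor 1/‖u‖ cancels. Keeping s as a parameter treats both orientations at
once. -/
theorem mem_halfSpace_smul_normal {X : PointSet d N} {I : Finset (Fin N)}
    (hX : LinearIndependent ℝ (fun i : I => X i)) (hI : I.Nonempty) (s : ℝ)
    (x : EuclideanSpace ℝ (Fin d)) :
    x ∈ halfSpace (s • normal X I) (s * height X I) ↔ s ≤ s * inner ℝ (facetVec X I) x := by
  have h : 0 < ‖facetVec X I‖⁻¹ := inv_pos.2 (norm_pos_iff.2 (facetVec_ne_zero hX hI))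
  rw [normal_eq hX, height_eq hX]
  simp only [halfSpace, Set.mem_ofPred_eq, real_inner_smul_left]
  rw [mul_left_comm, mul_comm s, mul_le_mul_iff_right₀ h]

theorem contDiffAt_facetVec {X : PointSet d N} {I : Finset (Fin N)}
    (hX : LinearIndependent ℝ (fun i : I => X i)) :
    ContDiffAt ℝ 1 (fun Y : PointSet d N => facetVec Y I) X := by
  have hc : ∀ (i : Fin N) (k : Fin d), ContDiffAt ℝ 1 (fun Y : PointSet d N => Y i k) X :=
    fun i k => by fun_prop
  have hG : ∀ i j, ContDiffAt ℝ 1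
      (fun Y : PointSet d N => ((subMatrix Y I)ᵀ * subMatrix Y I) i j) X := fun i j => by
    simp only [Matrix.mul_apply, subMatrix, Matrix.transpose_apply, Matrix.of_apply]
    exact ContDiffAt.sum fun k _ => (hc _ _).mul (hc _ _)
  rw [contDiffAt_euclidean]
  intro k
  simp only [facetVec, Matrix.mulVec, dotProduct, gramInvOne, subMatrix, Matrix.of_apply,
    Pi.one_apply, mul_one]
  exact ContDiffAt.sum fun i _ => (hc _ _).mul (ContDiffAt.sum fun j _ =>
    contDiffAt_matrix_inv_apply hG (det_gram_ne_zero hX) i j)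

theorem eventually_linearIndependent {X : PointSet d N} {I : Finset (Fin N)}
    (hX : LinearIndependent ℝ (fun i : I => X i)) :
    ∀ᶠ Y : PointSet d N in 𝓝 X, LinearIndependent ℝ (fun i : I => Y i) := by
  have h : Continuous fun (Y : PointSet d N) (i : I) => Y i := by fun_prop
  exact h.continuousAt.eventually (hX.eventually)

theorem eventually_isGeneric {X : PointSet d N} (hX : IsGeneric X) :
    ∀ᶠ Y in 𝓝 X, IsGeneric Y := by
  simp only [IsGeneric, eventually_all]
  exact fun I hI => eventually_linearIndependent (hX I hI)

theorem exists_height_lipschitz {X : PointSet d N} {I : Finset (Fin N)}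
    (hX : LinearIndependent ℝ (fun i : I => X i)) (hI : I.Nonempty) :
    ∃ K : NNReal, ∃ U ∈ 𝓝 X, LipschitzOnWith K (fun Y : PointSet d N => height Y I) U := by
  have h : ContDiffAt ℝ 1 (fun Y : PointSet d N => ‖facetVec Y I‖⁻¹) X :=
    ((contDiffAt_facetVec hX).norm ℝ (facetVec_ne_zero hX hI)).inv
      (norm_ne_zero_iff.2 (facetVec_ne_zero hX hI))
  obtain ⟨K, U, hU, hL⟩ := h.exists_lipschitzOnWith
  refine ⟨K, U ∩ {Y | LinearIndependent ℝ (fun i : I => Y i)},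
    inter_mem hU (eventually_linearIndependent hX), fun Y hY Z hZ => ?_⟩
  simp only [height_eq hY.2, height_eq hZ.2]
  exact hL hY.1 hZ.1

end

/-! ### Supporting hyperplanes under perturbation. -/

section

open Filter

variable {d N : ℕ}

theorem span_eq_top {X : PointSet d N} (hX : IsGeneric X) {J : Finset (Fin N)} (hJ : J.card = d) :
    Submodule.span ℝ (X '' J) = ⊤ := by
  have h := (hX J hJ.le).span_eq_top_of_card_eq_finrank' (by simp [hJ])
  rwa [show Set.range (fun i : J => X i) = X '' J by ext x; simp] at h

theorem exists_ne_zero_inner_eq_zero (X : PointSet d N) {J : Finset (Fin N)} (hJ : J.card < d) :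
    ∃ v : EuclideanSpace ℝ (Fin d), v ≠ 0 ∧ ∀ j ∈ J, inner ℝ v (X j) = 0 := by
  classical
  have hcard : Module.finrank ℝ (Submodule.span ℝ (X '' J)) < d := by
    rw [← Finset.coe_image]
    exact ((finrank_span_finset_le_card _).trans Finset.card_image_le).trans_lt hJ
  have hne : (Submodule.span ℝ (X '' J))ᗮ ≠ ⊥ := fun h => by
    rw [Submodule.orthogonal_eq_bot_iff] at h
    rw [h, finrank_top, finrank_euclideanSpace_fin] at hcard
    exact hcard.false
  obtain ⟨v, hv, hv0⟩ := Submodule.exists_mem_ne_zero_of_ne_bot hne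
  exact ⟨v, hv0, fun j hj =>
    (Submodule.mem_orthogonal' _ _).1 hv _ (Submodule.subset_span ⟨j, hj, rfl⟩)⟩

/-- A nonempty polyhedron `{u | ∀ j ∈ K, b ≤ ⟨u, x⁽ʲ⁾⟩}` with at least `d` constraints in general
position has a vertex. -/
theorem exists_vertex {X : PointSet d N} (hX : IsGeneric X) {K : Finset (Fin N)}
    (hK : d ≤ K.card) {b : ℝ}
    (h : ∃ u : EuclideanSpace ℝ (Fin d), ∀ j ∈ K, b ≤ inner ℝ u (X j)) :
    ∃ u : EuclideanSpace ℝ (Fin d), (∀ j ∈ K, b ≤ inner ℝ u (X j)) ∧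
      ∃ J ⊆ K, J.card = d ∧ ∀ j ∈ J, inner ℝ u (X j) = b := by
  classical
  suffices H : ∀ n ≤ d, ∃ u : EuclideanSpace ℝ (Fin d), (∀ j ∈ K, b ≤ inner ℝ u (X j)) ∧
      ∃ J ⊆ K, J.card = n ∧ ∀ j ∈ J, inner ℝ u (X j) = b from H d le_rfl
  intro n
  induction n with
  | zero =>
    obtain ⟨u, hu⟩ := h
    exact fun _ => ⟨u, hu, ∅, by simp, by simp, by simp⟩
  | succ n ih =>
    intro hn
    obtain ⟨u, hu, J, hJK, hJ, hJt⟩ := ih (by omega)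
    -- A direction that keeps the tight constraints tight: d points of K span the space, so v cannot
    -- be orthogonal to all of K, and up to sign it moves towards some constraint.
    obtain ⟨v, ⟨j, hj, hvj⟩, hvJ⟩ : ∃ v : EuclideanSpace ℝ (Fin d),
        (∃ j ∈ K, inner ℝ v (X j) < 0) ∧ ∀ j ∈ J, inner ℝ v (X j) = 0 := by
      obtain ⟨v, hv0, hv⟩ := exists_ne_zero_inner_eq_zero X (J := J) (by omega)
      obtain ⟨j, hj, hvj⟩ : ∃ j ∈ K, inner ℝ v (X j) ≠ 0 := by
        by_contra! hc
        obtain ⟨J', hJ'K, hJ'⟩ := Finset.exists_subset_card_eq hK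
        have hs := span_eq_top hX hJ'
        exact hv0 (eq_of_inner_eq (X := X) (I := J') (hs ▸ Submodule.mem_top)
          (Submodule.zero_mem _) fun i hi => by rw [hc i (hJ'K hi), inner_zero_left])
      rcases hvj.lt_or_gt with hlt | hlt
      · exact ⟨v, ⟨j, hj, hlt⟩, hv⟩
      · exact ⟨-v, ⟨j, hj, by rw [inner_neg_left]; linarith⟩, fun i hi => by
          rw [inner_neg_left, hv i hi, neg_zero]⟩
    -- Ratio test: move along v until the first constraint becomes tight.
    obtain ⟨j₀, hj₀, hmin⟩ := (K.filter fun j => inner ℝ v (X j) < 0).exists_min_image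
      (fun j => (inner ℝ u (X j) - b) / -inner ℝ v (X j)) ⟨j, by simp [hj, hvj]⟩
    obtain ⟨hj₀K, hj₀v⟩ := Finset.mem_filter.1 hj₀
    set τ := (inner ℝ u (X j₀) - b) / -inner ℝ v (X j₀) with hτ
    have hτ0 : 0 ≤ τ := div_nonneg (sub_nonneg.2 (hu _ hj₀K)) (by linarith)
    have hexp : ∀ i, inner ℝ (u + τ • v) (X i) = inner ℝ u (X i) + τ * inner ℝ v (X i) :=
      fun i => by rw [inner_add_left, real_inner_smul_left]
    refine ⟨u + τ • v, fun i hi => ?_, insert j₀ J, ?_, ?_, ?_⟩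
    · rw [hexp]
      rcases lt_or_ge (inner ℝ v (X i)) 0 with hlt | hge
      · have := hmin i (by simp [hi, hlt])
        rw [le_div_iff₀ (by linarith)] at this
        linarith
      · have := hu i hi
        nlinarith
    · exact Finset.insert_subset hj₀K hJK
    · rw [Finset.card_insert_of_notMem (fun hmem => hj₀v.ne (hvJ _ hmem)), hJ]
    · intro i hi
      rw [hexp]
      rcases Finset.mem_insert.1 hi with rfl | hi
      · rw [hτ, div_mul_eq_mul_div, div_neg, mul_div_cancel_right₀ _ hj₀v.ne]
        ring
      · rw [hvJ i hi, hJt i hi, mul_zero, add_zero]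

theorem eventually_lt_inner_facetVec {Y : PointSet d N} {I : Finset (Fin N)}
    (hY : LinearIndependent ℝ (fun i : I => Y i)) (s : ℝ) {j : Fin N} {a : ℝ}
    (h : a < s * inner ℝ (facetVec Y I) (Y j)) :
    ∀ᶠ X in 𝓝 Y, a < s * inner ℝ (facetVec X I) (X j) := by
  have hj : ContinuousAt (fun X : PointSet d N => X j) Y := by fun_prop
  exact (((contDiffAt_facetVec hY).continuousAt.inner hj).const_mul s).eventually_const_lt h

theorem eventually_inner_facetVec_lt {Y : PointSet d N} {I : Finset (Fin N)}
    (hY : LinearIndependent ℝ (fun i : I => Y i)) (s : ℝ) {j : Fin N} {a : ℝ}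
    (h : s * inner ℝ (facetVec Y I) (Y j) < a) :
    ∀ᶠ X in 𝓝 Y, s * inner ℝ (facetVec X I) (X j) < a := by
  have hj : ContinuousAt (fun X : PointSet d N => X j) Y := by fun_prop
  exact (((contDiffAt_facetVec hY).continuousAt.inner hj).const_mul s).eventually_lt_const h

/-- If the points of `Y` on the hyperplane `⟨u, ·⟩ = 1`, `u = facetVec Y I`, are perturbed, then
some hyperplane through perturbed points supports all of them from the side given by `s = ±1`. -/
theorem eventually_exists_supporting (hd : 1 ≤ d) {Y : PointSet d N} (hY : IsGeneric Y)
    {I : Finset (Fin N)} (hI : I ∈ indexFamily d N) {s : ℝ} (hs : s = 1 ∨ s = -1) :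
    ∀ᶠ X in 𝓝 Y, ∃ J ∈ indexFamily d N, facetVec Y J = facetVec Y I ∧
      ∀ j, s ≤ s * inner ℝ (facetVec Y I) (Y j) → s ≤ s * inner ℝ (facetVec X J) (X j) := by
  classical
  have hss : s * s = 1 := by rcases hs with rfl | rfl <;> norm_num
  -- K may have more than d elements: genericity does not prevent many points from lying on one
  -- affine hyperplane.
  let K : Finset (Fin N) := {j | inner ℝ (facetVec Y I) (Y j) = 1}
  have hIK : I ⊆ K := fun i hi => by simpa [K] using inner_facetVec (hY I hI.2) hi
  have hnear : ∀ᶠ X : PointSet d N in 𝓝 Y, ∀ j ∈ K, 1 / 2 < inner ℝ (facetVec Y I) (X j) := by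
    rw [eventually_all_finset]
    intro j hj
    have hj1 : inner ℝ (facetVec Y I) (Y j) = 1 := by simpa [K] using hj
    have hc : ContinuousAt (fun X : PointSet d N => inner ℝ (facetVec Y I) (X j)) Y := by fun_prop
    exact hc.eventually_const_lt (by norm_num [hj1])
  have hstrict : ∀ᶠ X in 𝓝 Y, ∀ J : Finset (Fin N), J.card ≤ d →
      facetVec Y J = facetVec Y I → ∀ j, s < s * inner ℝ (facetVec Y I) (Y j) →
        s < s * inner ℝ (facetVec X J) (X j) := by
    simp only [eventually_all]
    intro J hJ hJI j hj
    exact eventually_lt_inner_facetVec (hY J hJ) s (by rwa [hJI])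
  filter_upwards [eventually_isGeneric hY, hnear, hstrict] with X hX hnear hstrict
  suffices H : ∃ J ∈ indexFamily d N, facetVec Y J = facetVec Y I ∧
      ∀ j ∈ K, s ≤ s * inner ℝ (facetVec X J) (X j) by
    obtain ⟨J, hJ, hJI, hJK⟩ := H
    refine ⟨J, hJ, hJI, fun j hj => ?_⟩
    rcases hj.lt_or_eq with hlt | heq
    · exact (hstrict J hJ.2 hJI j hlt).le
    · refine hJK j ?_
      simp only [K, Finset.mem_filter, Finset.mem_univ, true_and]
      linear_combination (-s) * heq + (1 - inner ℝ (facetVec Y I) (Y j)) * hss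
  have hfacet : ∀ J ⊆ K, J.card ≤ d → facetVec Y I ∈ Submodule.span ℝ (Y '' J) →
      facetVec Y J = facetVec Y I := fun J hJK hJ hmem =>
    eq_of_inner_eq (facetVec_mem_span Y J) hmem fun i hi => by
      rw [inner_facetVec (hY J hJ) hi, (by simpa [K] using hJK hi :
        inner ℝ (facetVec Y I) (Y i) = 1)]
  -- With at most d boundary points, the hyperplane through all the perturbed ones works. Otherwise
  -- a vertex of a polyhedron selects d of them and keeps the rest on the correct side.
  rcases le_or_gt K.card d with hK | hK
  · refine ⟨K, ⟨hI.1.trans (Finset.card_le_card hIK), hK⟩, hfacet K subset_rfl hK ?_, ?_⟩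
    · exact Submodule.span_mono (Set.image_mono (by exact_mod_cast hIK)) (facetVec_mem_span Y I)
    · intro j hj
      rw [inner_facetVec (hX K hK) hj, mul_one]
  · obtain ⟨u, hu, J, hJK, hJ, hJt⟩ := exists_vertex (b := s) hX hK.le
      -- This feasible point is 2u for s = 1, where the bound 1/2 suffices, and 0 for s = -1.
      ⟨(1 + s) • facetVec Y I, fun j hj => by
        rw [real_inner_smul_left]
        have := hnear j hj
        rcases hs with rfl | rfl <;> linarith⟩
    refine ⟨J, ⟨hJ.symm ▸ hd, hJ.le⟩, hfacet J hJK hJ.le (span_eq_top hY hJ ▸ Submodule.mem_top),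
      fun j hj => ?_⟩
    have hJu : facetVec X J = s • u :=
      eq_of_inner_eq (facetVec_mem_span X J) (span_eq_top hX hJ ▸ Submodule.mem_top) fun i hi => by
        rw [inner_facetVec (hX J hJ.le) hi, real_inner_smul_left, hJt i hi, hss]
    rw [hJu, real_inner_smul_left, ← mul_assoc, hss, one_mul]
    exact hu j hj

/-! ### From local comparison to the Lipschitz bound. -/

/-- The difference of empirical and cap measure of the cap determined by `I`, on the side given by
`s = ±1`. -/
def capExcess (X : PointSet d N) (I : Finset (Fin N)) (s : ℝ) : ℝ :=
  extEmpMeasure X (s • normal X I) (s * height X I) - extCapMeasure d (s * height X I)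

theorem capDiscrepancy_eq (X : PointSet d N) :
    capDiscrepancy X = ⨆ I : indexFamily d N, max (capExcess X I 1) (capExcess X I (-1)) := by
  simp [capDiscrepancy, capExcess]

theorem capExcess_le_capExcess_add {C : ℝ}
    (hC : ∀ a b, |extCapMeasure d a - extCapMeasure d b| ≤ C * |a - b|)
    {X Y : PointSet d N} {I J : Finset (Fin N)} (hX : IsGeneric X) (hY : IsGeneric Y)
    (hI : I ∈ indexFamily d N) (hJ : J ∈ indexFamily d N) {s : ℝ} (hs : s = 1 ∨ s = -1)
    (h : ∀ j, s ≤ s * inner ℝ (facetVec X I) (X j) → s ≤ s * inner ℝ (facetVec Y J) (Y j)) :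
    capExcess X I s ≤ capExcess Y J s + C * |height X I - height Y J| := by
  have hemp : extEmpMeasure X (s • normal X I) (s * height X I) ≤
      extEmpMeasure Y (s • normal Y J) (s * height Y J) := by
    unfold extEmpMeasure
    gcongr with j hj
    · exact Set.toFinite _
    · have h1 := (mem_halfSpace_smul_normal (hX I hI.2) (Finset.card_pos.1 hI.1) s (X j))
      have h2 := (mem_halfSpace_smul_normal (hY J hJ.2) (Finset.card_pos.1 hJ.1) s (Y j))
      exact fun hj => h2.2 (h j (h1.1 hj))
  have hcap := (abs_le.1 (hC (s * height X I) (s * height Y J))).1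
  have habs : |s * height X I - s * height Y J| = |height X I - height Y J| := by
    rw [← mul_sub, abs_mul]
    rcases hs with rfl | rfl <;> simp
  rw [habs] at hcap
  unfold capExcess
  linarith

/-- Each cap of either set is dominated by some cap of the other, up to C times a change of height.
M is quantified after X, so that it may depend on the distance to Y. -/
theorem eventually_abs_capDiscrepancy_sub_le (hd : 1 ≤ d) (hN : 1 ≤ N) {C : ℝ} (hC0 : 0 ≤ C)
    (hC : ∀ a b, |extCapMeasure d a - extCapMeasure d b| ≤ C * |a - b|)
    {Y : PointSet d N} (hY : IsGeneric Y) :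
    ∀ᶠ X in 𝓝 Y, ∀ M : ℝ, (∀ I ∈ indexFamily d N, |height X I - height Y I| ≤ M) →
      |capDiscrepancy X - capDiscrepancy Y| ≤ C * M := by
  have : Nonempty (indexFamily d N) := ⟨⟨{⟨0, hN⟩}, by simp, by simpa⟩⟩
  have hbdd : ∀ X : PointSet d N, BddAbove (Set.range fun I : indexFamily d N =>
      max (capExcess X I 1) (capExcess X I (-1))) := fun X => (Set.finite_range _).bddAbove
  have hle : ∀ {X X' : PointSet d N} {ε : ℝ}, (∀ I ∈ indexFamily d N, ∀ s : ℝ, s = 1 ∨ s = -1 →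
      ∃ J ∈ indexFamily d N, capExcess X I s ≤ capExcess X' J s + ε) →
        capDiscrepancy X ≤ capDiscrepancy X' + ε := by
    intro X X' ε h
    rw [capDiscrepancy_eq, capDiscrepancy_eq]
    refine ciSup_le fun I => max_le ?_ ?_
    · obtain ⟨J, hJ, hIJ⟩ := h I I.2 1 (Or.inl rfl)
      exact hIJ.trans (add_le_add_left ((le_max_left _ _).trans (le_ciSup (hbdd X') ⟨J, hJ⟩)) _)
    · obtain ⟨J, hJ, hIJ⟩ := h I I.2 (-1) (Or.inr rfl)
      exact hIJ.trans (add_le_add_left ((le_max_right _ _).trans (le_ciSup (hbdd X') ⟨J, hJ⟩)) _)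
  have hlow : ∀ᶠ X in 𝓝 Y, ∀ I ∈ indexFamily d N, ∀ s : ℝ, s = 1 ∨ s = -1 →
      ∃ J ∈ indexFamily d N, facetVec Y J = facetVec Y I ∧
        ∀ j, s ≤ s * inner ℝ (facetVec Y I) (Y j) → s ≤ s * inner ℝ (facetVec X J) (X j) := by
    simp only [eventually_all]
    intro I hI
    filter_upwards [eventually_exists_supporting hd hY hI (Or.inl rfl),
      eventually_exists_supporting hd hY hI (Or.inr rfl)] with X h1 h2 s hs
    rcases hs with rfl | rfl
    exacts [h1, h2]
  have hup : ∀ᶠ X in 𝓝 Y, ∀ I ∈ indexFamily d N, ∀ s : ℝ, s = 1 ∨ s = -1 →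
      ∀ j, s * inner ℝ (facetVec Y I) (Y j) < s → s * inner ℝ (facetVec X I) (X j) < s := by
    simp only [eventually_all]
    intro I hI
    have key : ∀ s : ℝ, ∀ᶠ X in 𝓝 Y, ∀ j, s * inner ℝ (facetVec Y I) (Y j) < s →
        s * inner ℝ (facetVec X I) (X j) < s := fun s => by
      simp only [eventually_all]
      exact fun j hj => eventually_inner_facetVec_lt (hY I hI.2) s hj
    filter_upwards [key 1, key (-1)] with X h1 h2 s hs
    rcases hs with rfl | rfl
    exacts [h1, h2]
  filter_upwards [eventually_isGeneric hY, hlow, hup] with X hX hlow hup M hM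
  rw [abs_sub_le_iff]
  constructor
  · rw [sub_le_iff_le_add']
    refine hle fun I hI s hs => ⟨I, hI, ?_⟩
    refine (capExcess_le_capExcess_add hC hX hY hI hI hs fun j hj => ?_).trans ?_
    · by_contra! hlt
      exact (hup I hI s hs j hlt).not_ge hj
    · gcongr
      exact hM I hI
  · rw [sub_le_iff_le_add']
    refine hle fun I hI s hs => ?_
    obtain ⟨J, hJ, hJI, hsupp⟩ := hlow I hI s hs
    refine ⟨J, hJ, (capExcess_le_capExcess_add hC hY hX hI hJ hs hsupp).trans ?_⟩
    gcongr
    -- I and J have the same facet vector at Y, hence the same height there.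
    rw [height_eq (hY I hI.2), ← hJI, ← height_eq (hY J hJ.2), abs_sub_comm]
    exact hM J hJ

/-- A function on a convex set that is calm at every point with a uniform constant is
Lipschitz. -/
theorem abs_sub_le_of_eventually_abs_sub_le {E : Type*} [NormedAddCommGroup E] [NormedSpace ℝ E]
    {f : E → ℝ} {U : Set E} (hU : Convex ℝ U) {L : ℝ}
    (h : ∀ y ∈ U, ∀ᶠ x in 𝓝[U] y, |f x - f y| ≤ L * ‖x - y‖) {x y : E} (hx : x ∈ U) (hy : y ∈ U) :
    |f y - f x| ≤ L * ‖y - x‖ := by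
  let γ : ℝ → E := fun t => x + t • (y - x)
  have hγc : Continuous γ := by fun_prop
  have hγU : ∀ t ∈ Set.Icc (0 : ℝ) 1, γ t ∈ U := fun t ht => hU.add_smul_sub_mem hx hy ht
  have hγ : ∀ s t, γ s - γ t = (s - t) • (y - x) := fun s t => by
    simp only [γ]; module
  have hloc : ∀ t ∈ Set.Icc (0 : ℝ) 1, ∀ᶠ s in 𝓝[Set.Icc 0 1] t,
      |f (γ s) - f (γ t)| ≤ L * ‖y - x‖ * |s - t| := fun t ht => by
    have htend : Tendsto γ (𝓝[Set.Icc 0 1] t) (𝓝[U] (γ t)) :=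
      tendsto_nhdsWithin_of_tendsto_nhds_of_eventually_within _
        (hγc.continuousAt.mono_left inf_le_left)
        (eventually_mem_nhdsWithin.mono hγU)
    filter_upwards [htend.eventually (h _ (hγU t ht))] with s hs
    rwa [hγ, norm_smul, Real.norm_eq_abs, mul_comm |s - t|, ← mul_assoc] at hs
  have hcont : ContinuousOn (fun t => f (γ t)) (Set.Icc 0 1) := fun t ht => by
    refine tendsto_iff_norm_sub_tendsto_zero.2 (squeeze_zero' (Eventually.of_forall fun _ =>
      norm_nonneg _) (hloc t ht) ?_)
    have : Continuous fun s : ℝ => L * ‖y - x‖ * |s - t| := by fun_prop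
    simpa using (this.tendsto t).mono_left (nhdsWithin_le_nhds (s := Set.Icc (0 : ℝ) 1))
  -- Mean value inequality on the segment: a continuous function whose right slopes are bounded by a
  -- constant grows at most linearly, with no differentiability needed.
  have hbound := image_le_of_liminf_slope_right_le_deriv_boundary
    (f := fun t => |f (γ t) - f (γ 0)|) (a := 0) (b := 1)
    (B := fun t => L * ‖y - x‖ * t) (B' := fun _ => L * ‖y - x‖)
    (hcont.sub continuousOn_const).abs (by simp) (by fun_prop)
    (fun t _ => by simpa using ((hasDerivAt_id t).const_mul (L * ‖y - x‖)).hasDerivWithinAt)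
    (fun t ht r hr => by
      have hev : ∀ᶠ s in 𝓝[>] t, |f (γ s) - f (γ t)| ≤ L * ‖y - x‖ * |s - t| := by
        have := hloc t ⟨ht.1, ht.2.le⟩
        rw [eventually_nhdsWithin_iff] at this ⊢
        filter_upwards [this, eventually_lt_nhds ht.2] with s hs hs1 hst
        exact hs ⟨ht.1.trans (le_of_lt hst), hs1.le⟩
      refine Eventually.frequently ?_
      filter_upwards [hev, self_mem_nhdsWithin] with s hs hst
      have hst : 0 < s - t := sub_pos.2 hst
      rw [slope_def_field, div_lt_iff₀ hst]
      rw [abs_of_pos hst] at hs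
      have := abs_sub_abs_le_abs_sub (f (γ s) - f (γ 0)) (f (γ t) - f (γ 0))
      rw [sub_sub_sub_cancel_right] at this
      nlinarith)
  simpa [γ] using hbound (Set.right_mem_Icc.2 zero_le_one)

theorem exists_nhds_capDiscrepancy_lipschitz (hd : 3 ≤ d) (hN : 1 ≤ N)
    {Xbar : PointSet d N} (hX : IsGeneric Xbar) :
    ∃ U ∈ 𝓝 Xbar,
      (∀ X ∈ U, IsGeneric X) ∧
      ∃ L : ℝ, 0 < L ∧ ∀ X₁ ∈ U, ∀ X₂ ∈ U,
        |capDiscrepancy X₁ - capDiscrepancy X₂| ≤ L * ‖X₁ - X₂‖ := by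
  have := Fintype.ofFinite (indexFamily d N)
  obtain ⟨C, hC0, hC⟩ := exists_extCapMeasure_sub_le hd
  have hh : ∀ I : indexFamily d N, ∃ K : NNReal, ∃ U ∈ 𝓝 Xbar,
      LipschitzOnWith K (fun Y : PointSet d N => height Y I) U := fun I =>
    exists_height_lipschitz (hX I I.2.2) (Finset.card_pos.1 I.2.1)
  choose K V hV hK using hh
  obtain ⟨r, hr, hball⟩ := Metric.mem_nhds_iff.1
    (inter_mem (iInter_mem.2 hV) (eventually_isGeneric hX))
  -- The sum of the K I is a common Lipschitz constant for all heights. The summand 1 only makes L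
  -- positive.
  refine ⟨Metric.ball Xbar r, Metric.ball_mem_nhds _ hr, fun X hXU => (hball hXU).2,
    C * (∑ I, K I : NNReal) + 1, by positivity, fun X₁ h₁ X₂ h₂ => ?_⟩
  refine abs_sub_le_of_eventually_abs_sub_le (convex_ball Xbar r) (fun Y hY => ?_) h₂ h₁
  filter_upwards [self_mem_nhdsWithin, (eventually_abs_capDiscrepancy_sub_le (by omega) hN hC0 hC
    (hball hY).2).filter_mono nhdsWithin_le_nhds] with X hXU hXY
  refine (hXY ((∑ I, K I : NNReal) * ‖X - Y‖) fun I hI => ?_).trans ?_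
  · have hle : K ⟨I, hI⟩ ≤ ∑ I, K I :=
      Finset.single_le_sum (f := K) (fun _ _ => zero_le) (Finset.mem_univ _)
    have := ((hK ⟨I, hI⟩).mono fun Z hZ => Set.mem_iInter.1 (hball hZ).1 ⟨I, hI⟩).weaken hle
    simpa [Real.norm_eq_abs] using this.norm_sub_le hXU hY
  · nlinarith [norm_nonneg (X - Y)]

end

end SphericalCap

end

theorem theorem4p8 (d N : ℕ) (hd : 3 ≤ d) (hN : 1 ≤ N)
    (Xbar : SphericalCap.PointSet d N) (hX : SphericalCap.IsGeneric Xbar) :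
    ∃ U ∈ 𝓝 Xbar,
      (∀ X ∈ U, SphericalCap.IsGeneric X) ∧
      ∃ L : ℝ, 0 < L ∧ ∀ X₁ ∈ U, ∀ X₂ ∈ U,
        |SphericalCap.capDiscrepancy X₁ - SphericalCap.capDiscrepancy X₂| ≤ L * ‖X₁ - X₂‖ :=
  SphericalCap.exists_nhds_capDiscrepancy_lipschitz hd hN hX
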